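/- Let $J\subset\mathbb R$ be a bounded nondegenerate interval, and write $\langle\varphi\rangle_I=\frac1{|I|}\int_I\varphi(s)\,ds$. For $\varphi\in L^1(J)$ put $$\|\varphi\|_{\mathrm{BMO}(J)}^2=\sup_{I\subset J}\frac1{|I|}\int_I|\varphi(s)-\langle\varphi\rangle_I|^2\,ds\in[0,\infty],$$ where the supremum is over all (not only dyadic) nondegenerate subintervals $I$ of $J$. For $\varepsilon>0$ let $\mathrm{BMO}_\varepsilon(J)$ be the set of real-valued $\varphi\in L^1(J)$ with $\|\varphi\|_{\mathrm{BMO}(J)}\le\varepsilon$. Let $$\Omega_\varepsilon=\{x=(x_1,x_2)\in\mathbb R^2:\ x_1^2\le x_2\le x_1^2+\varepsilon^2\},$$ and, for $x\in\Omega_\varepsilon$, let $$\mathbf B(x;\varepsilon)=\sup\bigl\{\langle e^\varphi\rangle_J:\ \varphi\in\mathrm{BMO}_\varepsilon(J),\ \langle\varphi\rangle_J=x_1,\ \langle\varphi^2\rangle_J=x_2\bigr\}\in[0,\infty].$$ **Theorem.** Let $x\in\Omega_\varepsilon$. If $0<\varepsilon<1$, then $$\mathbf B(x;\varepsilon)=\frac{1-\sqrt{\varepsilon^2-x_2+x_1^2}}{1-\varepsilon}\,\exp\Bigl\{x_1+\sqrt{\varepsilon^2-x_2+x_1^2}-\varepsilon\Bigr\}.$$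 If $\varepsilon\ge1$, then $\mathbf B(x;\varepsilon)=\infty$ whenever $x_2>x_1^2$, while $\mathbf B(x;\varepsilon)=e^{x_1}$ when $x_2=x_1^2$. -/

import Mathlib

open MeasureTheory
open scoped ENNReal

namespace JohnNirenberg

/-- The average `⟨φ⟩_I` over the interval `I = [c, d]`. -/
noncomputable def avg (c d : ℝ) (φ : ℝ → ℝ) : ℝ := ⨍ s in Set.Icc c d, φ s

/-- The mean square oscillation `(1/|I|) ∫_I |φ - ⟨φ⟩_I|²` over `I = [c, d]`, as an extended
nonnegative number (it is `∞` when `φ` is integrable but not square integrable on `I`). -/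
noncomputable def meanSqOsc (c d : ℝ) (φ : ℝ → ℝ) : ℝ≥0∞ :=
  ⨍⁻ s, ‖φ s - avg c d φ‖ₑ ^ 2 ∂(volume.restrict (Set.Icc c d))

/-- The `L²`-based BMO norm on `J = [a, b]`: its square is the supremum of the mean square
oscillations over all (not only dyadic) nondegenerate subintervals `[c, d] ⊆ [a, b]`. -/
noncomputable def bmoNorm (a b : ℝ) (φ : ℝ → ℝ) : ℝ≥0∞ :=
  (⨆ (c : ℝ) (d : ℝ) (_ : a ≤ c) (_ : c < d) (_ : d ≤ b), meanSqOsc c d φ) ^ (1 / 2 : ℝ)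

/-- The closed ball `BMO_ε(J)`, `J = [a, b]`: the functions `φ ∈ L¹(J)` with `‖φ‖_{BMO(J)} ≤ ε`.
Functions are defined on all of `ℝ`; only their restrictions to `J` matter. -/
def bmoBall (a b ε : ℝ) : Set (ℝ → ℝ) :=
  {φ | IntegrableOn φ (Set.Icc a b) ∧ bmoNorm a b φ ≤ ENNReal.ofReal ε}

/-- The average `⟨e^φ⟩_J` over `J = [a, b]`, with value `∞` when `e^φ` is not summable. -/
noncomputable def expAvg (a b : ℝ) (φ : ℝ → ℝ) : ℝ≥0∞ :=
  ⨍⁻ s, ENNReal.ofReal (Real.exp (φ s)) ∂(volume.restrict (Set.Icc a b))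

/-- The domain `Ω_ε`. -/
def Omega (ε : ℝ) : Set (ℝ × ℝ) :=
  {x | x.1 ^ 2 ≤ x.2 ∧ x.2 ≤ x.1 ^ 2 + ε ^ 2}

/-- The Bellman function `𝐁(x; ε)` of the interval `J = [a, b]`: the supremum in `[0, ∞]` of
`⟨e^φ⟩_J` over all `φ ∈ BMO_ε(J)` with `⟨φ⟩_J = x₁` and `⟨φ²⟩_J = x₂`. -/
noncomputable def bellman (a b ε : ℝ) (x : ℝ × ℝ) : ℝ≥0∞ :=
  sSup (expAvg a b ''
    {φ | φ ∈ bmoBall a b ε ∧ avg a b φ = x.1 ∧ avg a b (fun s => φ s ^ 2) = x.2})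

end JohnNirenberg

namespace JohnNirenberg

/-! This is a Bellman function argument: a locally concave majorant gives the upper bound, and a
logarithm attains it.

Upper bound for `ε < 1`. On the strip `x₁² ≤ x₂ < x₁² + δ²` the candidate is concave along every
segment inside the strip (`concaveOn_candidate`), and it equals `exp x₁` on the lower boundary.
Splitting an interval puts its Bellman point (mean of `φ`, mean of `φ²`) on the segment joining the
points of the two pieces. The strip is not convex, so this segment may leave it even when all three
points lie in the `ε`-strip. `exists_split` chooses the cut so that the segment stays in a slightly
wider strip, with a ratio bounded away from `0` and `1`. Iterating, the integral of the candidate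
over the pieces never exceeds its initial value, while the pieces shrink uniformly. Lebesgue
differentiation and Fatou give the bound by the candidate of any width `δ ∈ (ε, 1)`, and then `δ ↓
ε`.

Lower bound. The truncated logarithm `u + ε log⁺ (A / (s - a))` lies in the `ε`-ball, and its two
parameters can be fitted to any point above the lower boundary. Its exponential behaves like `(s -
a) ^ (-ε)` at `a`: it attains the candidate for `ε < 1` and is not integrable for `ε ≥ 1`. On the
lower boundary the variance is zero, so only constants compete. -/

/-- The candidate `(1 - r) / (1 - δ) * exp (x₁ + r - δ)`, `r = √(δ² - x₂ + x₁²)`. -/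
noncomputable def candidate (δ x₁ x₂ : ℝ) : ℝ :=
  (1 - √(δ ^ 2 - x₂ + x₁ ^ 2)) / (1 - δ) * Real.exp (x₁ + √(δ ^ 2 - x₂ + x₁ ^ 2) - δ)

/-! ### The candidate: concavity along segments, boundary values -/

/-- The quantity `y₂ - y₁²` at the point `y` dividing the segment from `p` to `q` in the
ratio `t : (1 - t)`. -/
def segVar (p₁ p₂ q₁ q₂ t : ℝ) : ℝ :=
  (p₂ + t * (q₂ - p₂)) - (p₁ + t * (q₁ - p₁)) ^ 2

/-- Along the segment `r r'` is affine, because `r²` is quadratic with leading coefficient `k²`. The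
second derivative then collapses to `-(1 - δ)⁻¹ E r (k + r')²`, where `E` is the exponential factor.
The strict inequality in the hypothesis keeps `r > 0`, hence `r` differentiable; this is what later
forces a second, larger width. -/
lemma concaveOn_candidate {δ p₁ p₂ q₁ q₂ : ℝ} (hδ : δ < 1)
    (h : ∀ t ∈ Set.Icc (0 : ℝ) 1, segVar p₁ p₂ q₁ q₂ t < δ ^ 2) :
    ConcaveOn ℝ (Set.Icc (0 : ℝ) 1)
      (fun t => candidate δ (p₁ + t * (q₁ - p₁)) (p₂ + t * (q₂ - p₂))) := by
  set k := q₁ - p₁ with hk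
  set m := q₂ - p₂ with hm
  set r : ℝ → ℝ := fun t => √(δ ^ 2 - (p₂ + t * m) + (p₁ + t * k) ^ 2) with hr
  have hpos : ∀ t ∈ Set.Icc (0 : ℝ) 1, 0 < δ ^ 2 - (p₂ + t * m) + (p₁ + t * k) ^ 2 := by
    intro t ht
    have := h t ht
    simp only [segVar, ← hk, ← hm] at this
    linarith
  have hrpos : ∀ t ∈ Set.Icc (0 : ℝ) 1, 0 < r t := fun t ht => Real.sqrt_pos.2 (hpos t ht)
  have hr' : ∀ t ∈ Set.Icc (0 : ℝ) 1,
      HasDerivAt r ((-m + 2 * (p₁ + t * k) * k) / (2 * r t)) t := by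
    intro t ht
    have h1 : HasDerivAt (fun t : ℝ => δ ^ 2 - (p₂ + t * m) + (p₁ + t * k) ^ 2)
        (-m + 2 * (p₁ + t * k) * k) t := by
      have ha : HasDerivAt (fun t : ℝ => p₂ + t * m) m t := by
        simpa using ((hasDerivAt_id t).mul_const m).const_add p₂
      have hb : HasDerivAt (fun t : ℝ => p₁ + t * k) k t := by
        simpa using ((hasDerivAt_id t).mul_const k).const_add p₁
      exact ((ha.const_sub (δ ^ 2)).add (hb.pow 2)).congr_deriv (by push_cast; ring)
    exact h1.sqrt (hpos t ht).ne'
  set E : ℝ → ℝ := fun t => Real.exp (p₁ + t * k + r t - δ) with hE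
  have hE' : ∀ t ∈ Set.Icc (0 : ℝ) 1,
      HasDerivAt E (E t * (k + (-m + 2 * (p₁ + t * k) * k) / (2 * r t))) t := by
    intro t ht
    have hb : HasDerivAt (fun t : ℝ => p₁ + t * k) k t := by
      simpa using ((hasDerivAt_id t).mul_const k).const_add p₁
    exact ((hb.add (hr' t ht)).sub_const δ).exp
  set f' : ℝ → ℝ := fun t =>
    (1 - δ)⁻¹ * (E t * (k - r t * k - (-m + 2 * (p₁ + t * k) * k) / 2)) with hf'
  have hd1 : ∀ t ∈ Set.Icc (0 : ℝ) 1,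
      HasDerivAt (fun t => candidate δ (p₁ + t * k) (p₂ + t * m)) (f' t) t := by
    intro t ht
    have h0 := (hrpos t ht).ne'
    have heq : (fun t => candidate δ (p₁ + t * k) (p₂ + t * m)) =
        fun t => (1 - δ)⁻¹ * ((1 - r t) * E t) := by
      funext t; simp only [candidate, hr, hE]; ring
    rw [heq]
    refine ((((hr' t ht).const_sub 1).mul (hE' t ht)).const_mul ((1 - δ)⁻¹)).congr_deriv ?_
    simp only [hf']; field_simp; ring
  have hd2 : ∀ t ∈ Set.Icc (0 : ℝ) 1,
      HasDerivAt f' ((1 - δ)⁻¹ * (-(E t * r t *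
        (k + (-m + 2 * (p₁ + t * k) * k) / (2 * r t)) ^ 2))) t := by
    intro t ht
    have h0 := (hrpos t ht).ne'
    have hb : HasDerivAt (fun t : ℝ => (-m + 2 * (p₁ + t * k) * k) / 2) (k * k) t := by
      have := (((((hasDerivAt_id t).mul_const k).const_add p₁).const_mul 2).mul_const
        k).const_add (-m) |>.div_const 2
      exact this.congr_deriv (by ring)
    refine (((hE' t ht).mul ((((hr' t ht).mul_const k).const_sub k).sub hb)).const_mul
      ((1 - δ)⁻¹)).congr_deriv ?_
    simp only [Pi.sub_apply]
    field_simp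
    ring
  refine concaveOn_of_hasDerivWithinAt2_nonpos (f' := f') (convex_Icc 0 1)
    (fun t ht => (hd1 t ht).continuousAt.continuousWithinAt)
    (fun t ht => (hd1 t (interior_subset ht)).hasDerivWithinAt)
    (fun t ht => (hd2 t (interior_subset ht)).hasDerivWithinAt) ?_
  intro t ht
  have h1 : 0 < (1 - δ)⁻¹ := inv_pos.2 (by linarith)
  have h2 := hrpos t (interior_subset ht)
  have h3 : 0 < E t := Real.exp_pos _
  have : 0 ≤ (1 - δ)⁻¹ * (E t * r t *
        (k + (-m + 2 * (p₁ + t * k) * k) / (2 * r t)) ^ 2) := by positivity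
  linarith

lemma candidate_nonneg {δ x₁ x₂ : ℝ} (hδ0 : 0 ≤ δ) (hδ : δ < 1) (h : x₁ ^ 2 ≤ x₂) :
    0 ≤ candidate δ x₁ x₂ := by
  have : √(δ ^ 2 - x₂ + x₁ ^ 2) ≤ 1 := by
    rw [Real.sqrt_le_one]
    nlinarith
  exact mul_nonneg (div_nonneg (by linarith) (by linarith)) (Real.exp_pos _).le

lemma candidate_self {δ : ℝ} (hδ0 : 0 ≤ δ) (hδ : δ < 1) (x₁ : ℝ) :
    candidate δ x₁ (x₁ ^ 2) = Real.exp x₁ := by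
  have : √(δ ^ 2 - x₁ ^ 2 + x₁ ^ 2) = δ := by rw [sub_add_cancel, Real.sqrt_sq hδ0]
  rw [candidate, this, div_self (by linarith)]
  simp

lemma continuous_candidate (δ : ℝ) : Continuous fun x : ℝ × ℝ => candidate δ x.1 x.2 := by
  unfold candidate; fun_prop

/-! ### Choosing the splitting point: geometry of the strip -/

/-- If the segment between the mean `x` and the half-way mean `y (1/2)` leaves the strip of
width `δ`, moving the splitting point makes the segment from `z τ` to `y τ` fit into it, at a
point which stays away from the ends. -/
lemma exists_split_of_bad {ε δ x₁ x₂ : ℝ} {y₁ y₂ z₁ z₂ : ℝ → ℝ} (hεδ : ε ^ 2 < δ ^ 2) (hδ : 0 < δ)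
    (hy₁ : ContinuousOn y₁ (Set.Icc 0 (1 / 2))) (hy₂ : ContinuousOn y₂ (Set.Icc 0 (1 / 2)))
    (hy₁0 : y₁ 0 = x₁) (hy₂0 : y₂ 0 = x₂)
    (h₁ : ∀ τ ∈ Set.Ioc (0 : ℝ) (1 / 2), τ * z₁ τ + (1 - τ) * y₁ τ = x₁)
    (h₂ : ∀ τ ∈ Set.Ioc (0 : ℝ) (1 / 2), τ * z₂ τ + (1 - τ) * y₂ τ = x₂)
    (hx : x₂ - x₁ ^ 2 ≤ ε ^ 2)
    (hy : ∀ τ ∈ Set.Ioc (0 : ℝ) (1 / 2), y₁ τ ^ 2 ≤ y₂ τ ∧ y₂ τ - y₁ τ ^ 2 ≤ ε ^ 2)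
    (hz : ∀ τ ∈ Set.Ioc (0 : ℝ) (1 / 2), z₁ τ ^ 2 ≤ z₂ τ)
    (hbad : ∃ μ ∈ Set.Icc (0 : ℝ) 1, δ ^ 2 ≤ segVar x₁ x₂ (y₁ (1 / 2)) (y₂ (1 / 2)) μ) :
    ∃ τ ∈ Set.Ioc (0 : ℝ) (1 / 2), √(δ ^ 2 - ε ^ 2) / δ ≤ τ ∧
      ∀ t ∈ Set.Icc (0 : ℝ) 1, segVar (z₁ τ) (z₂ τ) (y₁ τ) (y₂ τ) t ≤ δ ^ 2 := by
  set W : ℝ × ℝ → ℝ := fun w => segVar x₁ x₂ (y₁ w.1) (y₂ w.1) w.2 with hW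
  have hWc : ContinuousOn W (Set.Icc 0 (1 / 2) ×ˢ Set.Icc 0 1) := by
    have e1 : ContinuousOn (fun w : ℝ × ℝ => y₁ w.1) (Set.Icc 0 (1 / 2) ×ˢ Set.Icc 0 1) :=
      hy₁.comp continuousOn_fst (fun w hw => hw.1)
    have e2 : ContinuousOn (fun w : ℝ × ℝ => y₂ w.1) (Set.Icc 0 (1 / 2) ×ˢ Set.Icc 0 1) :=
      hy₂.comp continuousOn_fst (fun w hw => hw.1)
    exact (continuousOn_const.add (continuousOn_snd.mul (e2.sub continuousOn_const))).sub
      ((continuousOn_const.add (continuousOn_snd.mul (e1.sub continuousOn_const))).pow 2)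
  set K : Set (ℝ × ℝ) := (Set.Icc 0 (1 / 2) ×ˢ Set.Icc 0 1) ∩ W ⁻¹' Set.Ici (δ ^ 2) with hK
  have hKc : IsCompact K :=
    (isCompact_Icc.prod isCompact_Icc).of_isClosed_subset
      (hWc.preimage_isClosed_of_isClosed (isClosed_Icc.prod isClosed_Icc) isClosed_Ici)
      Set.inter_subset_left
  have hKn : K.Nonempty := by
    obtain ⟨μ, hμ, hb⟩ := hbad
    exact ⟨(1 / 2, μ), ⟨⟨by norm_num, by norm_num⟩, hμ⟩, hb⟩
  -- Take the least `τ` for which the segment from `x` to `y τ` reaches height `δ²`. It is positive,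
  -- since at `τ = 0` the segment degenerates to `x`, of height at most `ε²`; by continuity from the
  -- left the segment at `τ` does not exceed `δ²`.
  obtain ⟨⟨τ, μ⟩, ⟨⟨hτ, hμ⟩, hWτ⟩, hmin⟩ := hKc.exists_isMinOn hKn continuousOn_fst
  simp only [Set.mem_preimage, Set.mem_Ici] at hWτ
  simp only at hτ hμ
  have hmin' : ∀ τ' ∈ Set.Icc (0 : ℝ) (1 / 2), ∀ μ' ∈ Set.Icc (0 : ℝ) 1, τ' < τ →
      W (τ', μ') < δ ^ 2 := by
    intro τ' h1 μ' h2 h3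
    by_contra! hcon
    have : τ ≤ τ' := hmin (a := (τ', μ')) ⟨⟨h1, h2⟩, hcon⟩
    linarith
  have hτ0 : 0 < τ := by
    rcases hτ.1.lt_or_eq with h | h
    · exact h
    · exfalso
      rw [← h] at hWτ
      simp only [hW, segVar, hy₁0, hy₂0] at hWτ
      nlinarith
  have hτI : τ ∈ Set.Ioc (0 : ℝ) (1 / 2) := ⟨hτ0, hτ.2⟩
  have hle : ∀ μ' ∈ Set.Icc (0 : ℝ) 1, W (τ, μ') ≤ δ ^ 2 := by
    intro μ' hμ'
    have hc : ContinuousOn (fun τ' => W (τ', μ')) (Set.Icc 0 (1 / 2)) :=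
      hWc.comp (by fun_prop) (fun t ht => ⟨ht, hμ'⟩)
    have hc' : Filter.Tendsto (fun τ' => W (τ', μ')) (nhdsWithin τ (Set.Ico 0 τ))
        (nhds (W (τ, μ'))) :=
      (hc τ hτ).mono_left (nhdsWithin_mono _ fun t ht => ⟨ht.1, ht.2.le.trans hτ.2⟩)
    have hne : (nhdsWithin τ (Set.Ico 0 τ)).NeBot := by
      rw [← mem_closure_iff_nhdsWithin_neBot, closure_Ico hτ0.ne]
      exact ⟨hτ0.le, le_rfl⟩
    refine le_of_tendsto hc' ?_
    filter_upwards [self_mem_nhdsWithin] with t ht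
    exact (hmin' t ⟨ht.1, ht.2.le.trans hτ.2⟩ μ' hμ' ht.2).le
  have e1 := h₁ τ hτI
  have e2 := h₂ τ hτI
  obtain ⟨hy0, hye⟩ := hy τ hτI
  have hz0 := hz τ hτI
  simp only [hW] at hWτ hle
  clear hmin hmin' hW hWc
  refine ⟨τ, hτI, ?_⟩
  generalize y₁ τ = Y₁ at *
  generalize y₂ τ = Y₂ at *
  generalize z₁ τ = Z₁ at *
  generalize z₂ τ = Z₂ at *
  -- Both ends of the touching segment have height at most `ε²`, and a chord adds at most a quarter
  -- of its squared horizontal length, so a chord reaching `δ²` must be long.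
  have hgap : 4 * (δ ^ 2 - ε ^ 2) ≤ τ ^ 2 * (Y₁ - Z₁) ^ 2 := by
    have hD : Y₁ - x₁ = τ * (Y₁ - Z₁) := by linarith
    have hid : segVar x₁ x₂ Y₁ Y₂ μ = (1 - μ) * (x₂ - x₁ ^ 2) + μ * (Y₂ - Y₁ ^ 2)
        + μ * (1 - μ) * (Y₁ - x₁) ^ 2 := by simp only [segVar]; ring
    have h3 := mul_le_mul_of_nonneg_left hx (sub_nonneg.2 hμ.2)
    have h4 := mul_le_mul_of_nonneg_left hye hμ.1
    have h5 : μ * (1 - μ) * (Y₁ - x₁) ^ 2 ≤ 1 / 4 * (Y₁ - x₁) ^ 2 :=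
      mul_le_mul_of_nonneg_right (by nlinarith [sq_nonneg (μ - 1 / 2)]) (sq_nonneg _)
    rw [← mul_pow, ← hD]
    linarith
  have hall : ∀ t ∈ Set.Icc (0 : ℝ) 1, segVar Z₁ Z₂ Y₁ Y₂ t ≤ δ ^ 2 := by
    intro t ht
    rcases le_or_gt (1 - τ) t with h | h
    · convert hle ((t - (1 - τ)) / τ) ⟨div_nonneg (by linarith) hτ0.le,
        (div_le_one hτ0).2 (by linarith [ht.2])⟩ using 1
      simp only [segVar, ← e1, ← e2]
      field_simp
      ring
    -- On the side of `z`: the height is a concave quadratic in the parameter, with slope `S` at `x`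
    -- (parameter `1 - τ`). It reaches `δ²`, above its value at `x`, on the side of `y`; hence `S >
    -- 0`, and it stays below its value at `x` on the side of `z`.
    · set S := (Y₂ - Z₂) - 2 * x₁ * (Y₁ - Z₁) with hS
      have i1 : segVar x₁ x₂ Y₁ Y₂ μ =
          (x₂ - x₁ ^ 2) + τ * μ * S - (τ * μ * (Y₁ - Z₁)) ^ 2 := by
        simp only [segVar, hS, ← e1, ← e2]; ring
      have i2 : segVar Z₁ Z₂ Y₁ Y₂ t =
          (x₂ - x₁ ^ 2) + (t - (1 - τ)) * S - ((t - (1 - τ)) * (Y₁ - Z₁)) ^ 2 := by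
        simp only [segVar, hS, ← e1, ← e2]; ring
      have h3 : 0 ≤ τ * μ := mul_nonneg hτ0.le hμ.1
      have h4 : 0 < τ * μ * S := by
        rw [i1] at hWτ
        nlinarith [sq_nonneg (τ * μ * (Y₁ - Z₁))]
      have h5 : 0 < S := pos_of_mul_pos_right h4 h3
      rw [i2]
      nlinarith [sq_nonneg ((t - (1 - τ)) * (Y₁ - Z₁)), mul_pos (sub_pos.2 h) h5]
  refine ⟨?_, hall⟩
  -- The midpoint bound, with both ends above the parabola, limits the horizontal length to `2δ`.
  -- Together with `hgap` this bounds `τ` from below.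
  have hmid := hall (1 / 2) ⟨by norm_num, by norm_num⟩
  simp only [segVar] at hmid
  have hD : (Y₁ - Z₁) ^ 2 ≤ 4 * δ ^ 2 := by nlinarith
  rw [div_le_iff₀ hδ, Real.sqrt_le_left (by positivity)]
  nlinarith [mul_le_mul_of_nonneg_left hD (sq_nonneg τ)]

/-! ### Averages, variances and the BMO ball -/

lemma avg_eq {c d : ℝ} (h : c < d) (f : ℝ → ℝ) : avg c d f = (∫ s in c..d, f s) / (d - c) := by
  rw [avg, setAverage_eq, intervalIntegral.integral_of_le h.le, integral_Icc_eq_integral_Ioc,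
    Real.volume_real_Icc_of_le h.le, smul_eq_mul, div_eq_inv_mul]

lemma laverage_Icc_eq {c d : ℝ} (f : ℝ → ℝ≥0∞) :
    ⨍⁻ s, f s ∂(volume.restrict (Set.Icc c d)) =
      (∫⁻ s in Set.Icc c d, f s) / ENNReal.ofReal (d - c) := by
  rw [setLAverage_eq, Real.volume_Icc]

lemma avg_sub_const_sq {c d : ℝ} (h : c < d) {φ : ℝ → ℝ} (h₁ : IntegrableOn φ (Set.Icc c d))
    (h₂ : IntegrableOn (fun s => φ s ^ 2) (Set.Icc c d)) (k : ℝ) :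
    avg c d (fun s => (φ s - k) ^ 2) =
      avg c d (fun s => φ s ^ 2) - 2 * k * avg c d φ + k ^ 2 := by
  have i₁ : IntervalIntegrable φ volume c d :=
    (intervalIntegrable_iff_integrableOn_Icc_of_le h.le).2 h₁
  have i₂ : IntervalIntegrable (fun s => φ s ^ 2) volume c d :=
    (intervalIntegrable_iff_integrableOn_Icc_of_le h.le).2 h₂
  have h0 : d - c ≠ 0 := (sub_pos.2 h).ne'
  have e : (fun s => (φ s - k) ^ 2) = fun s => φ s ^ 2 - 2 * k * φ s + k ^ 2 := by
    funext s; ring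
  rw [avg_eq h, avg_eq h, avg_eq h, e, intervalIntegral.integral_add
    (i₂.sub (i₁.const_mul _)) intervalIntegrable_const, intervalIntegral.integral_sub i₂
    (i₁.const_mul _), intervalIntegral.integral_const_mul, intervalIntegral.integral_const]
  field_simp
  simp only [smul_eq_mul]
  ring

lemma integrableOn_sub_const_sq {c d : ℝ} {φ : ℝ → ℝ} (h₁ : IntegrableOn φ (Set.Icc c d))
    (h₂ : IntegrableOn (fun s => φ s ^ 2) (Set.Icc c d)) (k : ℝ) :
    IntegrableOn (fun s => (φ s - k) ^ 2) (Set.Icc c d) := by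
  have e : (fun s => (φ s - k) ^ 2) = fun s => φ s ^ 2 - 2 * k * φ s + k ^ 2 := by
    funext s; ring
  rw [e]
  exact (h₂.sub (h₁.const_mul _)).add (integrableOn_const (by simp))

lemma avg_nonneg {c d : ℝ} {f : ℝ → ℝ} (hf : ∀ s, 0 ≤ f s) : 0 ≤ avg c d f := by
  rw [avg, setAverage_eq]
  exact smul_nonneg (by positivity) (integral_nonneg hf)

lemma sq_avg_le {c d : ℝ} (h : c < d) {φ : ℝ → ℝ} (h₁ : IntegrableOn φ (Set.Icc c d))
    (h₂ : IntegrableOn (fun s => φ s ^ 2) (Set.Icc c d)) :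
    avg c d φ ^ 2 ≤ avg c d (fun s => φ s ^ 2) := by
  have := avg_sub_const_sq h h₁ h₂ (avg c d φ)
  have h0 : 0 ≤ avg c d (fun s => (φ s - avg c d φ) ^ 2) := avg_nonneg fun s => sq_nonneg _
  nlinarith

lemma enorm_sq_eq (x : ℝ) : ‖x‖ₑ ^ 2 = ENNReal.ofReal (x ^ 2) := by
  rw [Real.enorm_eq_ofReal_abs, ← ENNReal.ofReal_pow (abs_nonneg _), sq_abs]

lemma meanSqOsc_eq {c d : ℝ} (h : c < d) {φ : ℝ → ℝ} (h₁ : IntegrableOn φ (Set.Icc c d))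
    (h₂ : IntegrableOn (fun s => φ s ^ 2) (Set.Icc c d)) :
    meanSqOsc c d φ = ENNReal.ofReal (avg c d (fun s => φ s ^ 2) - avg c d φ ^ 2) := by
  have e := avg_sub_const_sq h h₁ h₂ (avg c d φ)
  have e' : avg c d (fun s => φ s ^ 2) - avg c d φ ^ 2 =
    avg c d (fun s => (φ s - avg c d φ) ^ 2) := by rw [e]; ring
  rw [e', meanSqOsc, laverage_Icc_eq]
  generalize avg c d φ = m
  rw [avg, setAverage_eq, Real.volume_real_Icc_of_le h.le,
    smul_eq_mul, ← div_eq_inv_mul, ENNReal.ofReal_div_of_pos (sub_pos.2 h),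
    ofReal_integral_eq_lintegral_ofReal (integrableOn_sub_const_sq h₁ h₂ _)
      (ae_of_all _ fun s => sq_nonneg _)]
  simp only [enorm_sq_eq]

lemma integrableOn_sq_of_meanSqOsc_ne_top {c d : ℝ} {φ : ℝ → ℝ}
    (h₁ : IntegrableOn φ (Set.Icc c d)) (hm : meanSqOsc c d φ ≠ ⊤) :
    IntegrableOn (fun s => φ s ^ 2) (Set.Icc c d) := by
  rw [meanSqOsc, laverage_Icc_eq] at hm
  have hfin : ∫⁻ s in Set.Icc c d, ‖φ s - avg c d φ‖ₑ ^ 2 ≠ ⊤ := by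
    intro htop
    exact hm (by rw [htop, ENNReal.top_div_of_ne_top ENNReal.ofReal_ne_top])
  have hi : IntegrableOn (fun s => (φ s - avg c d φ) ^ 2) (Set.Icc c d) := by
    refine ⟨(h₁.aestronglyMeasurable.sub aestronglyMeasurable_const).pow 2, ?_⟩
    rw [hasFiniteIntegral_iff_enorm]
    simpa only [enorm_pow] using hfin.lt_top
  have e : (fun s => φ s ^ 2) =
      fun s => (φ s - avg c d φ) ^ 2 + 2 * avg c d φ * φ s - avg c d φ ^ 2 := by
    funext s; ring
  rw [e]
  exact (hi.add (h₁.const_mul _)).sub (integrableOn_const (by simp))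

lemma bmoNorm_le_iff {a b ε : ℝ} (hε : 0 ≤ ε) {φ : ℝ → ℝ} :
    bmoNorm a b φ ≤ ENNReal.ofReal ε ↔
      ∀ c d, a ≤ c → c < d → d ≤ b → meanSqOsc c d φ ≤ ENNReal.ofReal (ε ^ 2) := by
  rw [bmoNorm, one_div, ENNReal.rpow_inv_le_iff (by norm_num)]
  simp only [iSup_le_iff]
  rw [ENNReal.ofReal_pow hε]
  norm_num

/-- Membership in the ball of `BMO`, in terms of averages. -/
lemma mem_bmoBall_iff {a b ε : ℝ} (hab : a < b) (hε : 0 ≤ ε) {φ : ℝ → ℝ} :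
    φ ∈ bmoBall a b ε ↔ IntegrableOn φ (Set.Icc a b) ∧
      IntegrableOn (fun s => φ s ^ 2) (Set.Icc a b) ∧
      ∀ c d, a ≤ c → c < d → d ≤ b →
        avg c d (fun s => φ s ^ 2) - avg c d φ ^ 2 ≤ ε ^ 2 := by
  simp only [bmoBall, Set.mem_ofPred_eq, bmoNorm_le_iff hε]
  refine and_congr_right fun h₁ => ⟨fun h => ?_, fun ⟨h₂, h⟩ c d hac hcd hdb => ?_⟩
  · have h₂ : IntegrableOn (fun s => φ s ^ 2) (Set.Icc a b) :=
      integrableOn_sq_of_meanSqOsc_ne_top h₁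
        (ne_top_of_le_ne_top ENNReal.ofReal_ne_top (h a b le_rfl hab le_rfl))
    refine ⟨h₂, fun c d hac hcd hdb => ?_⟩
    have hs := Set.Icc_subset_Icc hac hdb
    have := h c d hac hcd hdb
    rwa [meanSqOsc_eq hcd (h₁.mono_set hs) (h₂.mono_set hs),
      ENNReal.ofReal_le_ofReal_iff (sq_nonneg ε)] at this
  · have hs := Set.Icc_subset_Icc hac hdb
    rw [meanSqOsc_eq hcd (h₁.mono_set hs) (h₂.mono_set hs)]
    exact ENNReal.ofReal_le_ofReal (h c d hac hcd hdb)

lemma avg_eq_add {c m d : ℝ} (hcm : c < m) (hmd : m < d) {f : ℝ → ℝ}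
    (hf : IntegrableOn f (Set.Icc c d)) :
    avg c d f = (m - c) / (d - c) * avg c m f + (d - m) / (d - c) * avg m d f := by
  have i₁ : IntervalIntegrable f volume c m :=
    (intervalIntegrable_iff_integrableOn_Icc_of_le hcm.le).2
      (hf.mono_set (Set.Icc_subset_Icc le_rfl hmd.le))
  have i₂ : IntervalIntegrable f volume m d :=
    (intervalIntegrable_iff_integrableOn_Icc_of_le hmd.le).2
      (hf.mono_set (Set.Icc_subset_Icc hcm.le le_rfl))
  rw [avg_eq (hcm.trans hmd), avg_eq hcm, avg_eq hmd,
    ← intervalIntegral.integral_add_adjacent_intervals i₁ i₂]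
  have h1 : m - c ≠ 0 := (sub_pos.2 hcm).ne'
  have h2 : d - m ≠ 0 := (sub_pos.2 hmd).ne'
  have h3 : d - c ≠ 0 := (sub_pos.2 (hcm.trans hmd)).ne'
  field_simp

lemma continuousOn_avg_left {c d : ℝ} (h : c < d) {f : ℝ → ℝ}
    (hf : IntegrableOn f (Set.Icc c d)) :
    ContinuousOn (fun τ => avg (c + τ * (d - c)) d f) (Set.Icc 0 (1 / 2)) := by
  have hl := sub_pos.2 h
  have hlt : ∀ τ ∈ Set.Icc (0 : ℝ) (1 / 2), c + τ * (d - c) < d := fun τ hτ => by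
    nlinarith [hτ.1, hτ.2]
  have hc : ContinuousOn (fun τ => (∫ s in (c + τ * (d - c))..d, f s) / (d - (c + τ * (d - c))))
      (Set.Icc 0 (1 / 2)) := by
    refine ContinuousOn.div ?_ (by fun_prop) fun τ hτ => (sub_pos.2 (hlt τ hτ)).ne'
    rw [← Set.uIcc_of_le h.le] at hf
    refine (intervalIntegral.continuousOn_primitive_interval_left hf).comp
      (f := fun τ : ℝ => c + τ * (d - c)) (by fun_prop) fun τ hτ => ?_
    rw [Set.uIcc_of_le h.le]
    exact ⟨by nlinarith [hτ.1], (hlt τ hτ).le⟩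
  exact hc.congr fun τ hτ => avg_eq (hlt τ hτ) f

lemma continuousOn_avg_right {c d : ℝ} (h : c < d) {f : ℝ → ℝ}
    (hf : IntegrableOn f (Set.Icc c d)) :
    ContinuousOn (fun τ => avg c (d - τ * (d - c)) f) (Set.Icc 0 (1 / 2)) := by
  have hl := sub_pos.2 h
  have hlt : ∀ τ ∈ Set.Icc (0 : ℝ) (1 / 2), c < d - τ * (d - c) := fun τ hτ => by
    nlinarith [hτ.1, hτ.2]
  have hc : ContinuousOn (fun τ => (∫ s in c..(d - τ * (d - c)), f s) / (d - τ * (d - c) - c))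
      (Set.Icc 0 (1 / 2)) := by
    refine ContinuousOn.div ?_ (by fun_prop) fun τ hτ => (sub_pos.2 (hlt τ hτ)).ne'
    rw [← Set.uIcc_of_le h.le] at hf
    refine (intervalIntegral.continuousOn_primitive_interval hf).comp
      (f := fun τ : ℝ => d - τ * (d - c)) (by fun_prop) fun τ hτ => ?_
    rw [Set.uIcc_of_le h.le]
    exact ⟨(hlt τ hτ).le, by nlinarith [hτ.1]⟩
  exact hc.congr fun τ hτ => avg_eq (hlt τ hτ) f

/-! ### Splitting intervals and the upper bound -/

lemma segVar_symm (p₁ p₂ q₁ q₂ t : ℝ) : segVar p₁ p₂ q₁ q₂ t = segVar q₁ q₂ p₁ p₂ (1 - t) := by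
  simp only [segVar]; ring

/-- Every function in the ball of radius `ε` has a splitting point, uniformly inside the interval,
for which the segment joining the two means stays in the strip of width `δ > ε`. -/
lemma exists_split {ε δ c d : ℝ} {φ : ℝ → ℝ} (hεδ : ε ^ 2 < δ ^ 2) (hδ : 0 < δ) (hcd : c < d)
    (h₁ : IntegrableOn φ (Set.Icc c d)) (h₂ : IntegrableOn (fun s => φ s ^ 2) (Set.Icc c d))
    (hφ : ∀ c' d', c ≤ c' → c' < d' → d' ≤ d →
      avg c' d' (fun s => φ s ^ 2) - avg c' d' φ ^ 2 ≤ ε ^ 2) :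
    ∃ m ∈ Set.Ioo c d,
      m - c ≤ (1 - min (1 / 2) (√(δ ^ 2 - ε ^ 2) / δ)) * (d - c) ∧
      d - m ≤ (1 - min (1 / 2) (√(δ ^ 2 - ε ^ 2) / δ)) * (d - c) ∧
      ∀ t ∈ Set.Icc (0 : ℝ) 1, segVar (avg c m φ) (avg c m fun s => φ s ^ 2)
        (avg m d φ) (avg m d fun s => φ s ^ 2) t ≤ δ ^ 2 := by
  have hl := sub_pos.2 hcd
  have hsq : ∀ c' d', c ≤ c' → c' < d' → d' ≤ d →
      avg c' d' φ ^ 2 ≤ avg c' d' (fun s => φ s ^ 2) := fun c' d' h h' h'' =>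
    sq_avg_le h' (h₁.mono_set (Set.Icc_subset_Icc h h'')) (h₂.mono_set (Set.Icc_subset_Icc h h''))
  set θ := √(δ ^ 2 - ε ^ 2) / δ with hθ
  have hθ1 : min (1 / 2) θ ≤ 1 / 2 := min_le_left _ _
  have hθ2 : min (1 / 2) θ ≤ θ := min_le_right _ _
  -- Bisection is used if it works. Otherwise the bad point lies between the whole mean and the mean
  -- of one half, and that half is enlarged; the two cases below are mirror images.
  by_cases hall : ∀ t ∈ Set.Icc (0 : ℝ) 1,
      segVar (avg c (d - 1 / 2 * (d - c)) φ) (avg c (d - 1 / 2 * (d - c)) fun s => φ s ^ 2)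
        (avg (c + 1 / 2 * (d - c)) d φ) (avg (c + 1 / 2 * (d - c)) d fun s => φ s ^ 2) t ≤ δ ^ 2
  · have e : d - 1 / 2 * (d - c) = c + 1 / 2 * (d - c) := by ring
    rw [e] at hall
    refine ⟨_, ⟨by linarith, by linarith⟩, ?_, ?_, hall⟩ <;> nlinarith
  push Not at hall
  obtain ⟨t, ht, hbad⟩ := hall
  have hsum : ∀ τ ∈ Set.Ioc (0 : ℝ) (1 / 2), ∀ f : ℝ → ℝ, IntegrableOn f (Set.Icc c d) →
      τ * avg c (c + τ * (d - c)) f + (1 - τ) * avg (c + τ * (d - c)) d f = avg c d f := by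
    intro τ hτ f hf
    have : 0 < τ * (d - c) := mul_pos hτ.1 hl
    rw [avg_eq_add (m := c + τ * (d - c)) (by linarith) (by nlinarith [hτ.2]) hf]
    congr 2 <;> field_simp <;> ring
  have hsum' : ∀ τ ∈ Set.Ioc (0 : ℝ) (1 / 2), ∀ f : ℝ → ℝ, IntegrableOn f (Set.Icc c d) →
      τ * avg (d - τ * (d - c)) d f + (1 - τ) * avg c (d - τ * (d - c)) f = avg c d f := by
    intro τ hτ f hf
    have : 0 < τ * (d - c) := mul_pos hτ.1 hl
    rw [avg_eq_add (m := d - τ * (d - c)) (by nlinarith [hτ.2]) (by linarith) hf, add_comm]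
    congr 2 <;> field_simp <;> ring
  have hhalf : (1 / 2 : ℝ) ∈ Set.Ioc (0 : ℝ) (1 / 2) := ⟨by norm_num, le_rfl⟩
  rcases le_total (1 / 2) t with h | h
  · obtain ⟨τ, hτ, hθτ, hseg⟩ := exists_split_of_bad (ε := ε) (δ := δ)
      (x₁ := avg c d φ) (x₂ := avg c d fun s => φ s ^ 2)
      (z₁ := fun τ => avg c (c + τ * (d - c)) φ)
      (z₂ := fun τ => avg c (c + τ * (d - c)) fun s => φ s ^ 2) hεδ hδ
      (continuousOn_avg_left hcd h₁) (continuousOn_avg_left hcd h₂) (by simp) (by simp)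
      (fun τ hτ => hsum τ hτ _ h₁) (fun τ hτ => hsum τ hτ _ h₂) (hφ c d le_rfl hcd le_rfl)
      (fun τ hτ => ⟨hsq _ _ (by nlinarith [hτ.1]) (by nlinarith [hτ.2]) le_rfl,
        hφ _ _ (by nlinarith [hτ.1]) (by nlinarith [hτ.2]) le_rfl⟩)
      (fun τ hτ => hsq _ _ le_rfl (by nlinarith [hτ.1]) (by nlinarith [hτ.2]))
      -- The whole mean is the midpoint `t = 1 / 2` of the segment joining the two halves, whence
      -- the reparametrization.
      ⟨2 * t - 1, ⟨by linarith, by linarith [ht.2]⟩, by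
        refine hbad.le.trans_eq ?_
        rw [← hsum' _ hhalf _ h₁, ← hsum' _ hhalf _ h₂]
        have e : d - 1 / 2 * (d - c) = c + 1 / 2 * (d - c) := by ring
        simp only [segVar, e]
        ring⟩
    have : 0 < τ * (d - c) := mul_pos hτ.1 hl
    refine ⟨c + τ * (d - c), ⟨by linarith, by nlinarith [hτ.2]⟩, ?_, ?_, hseg⟩ <;>
      nlinarith [hτ.2]
  · obtain ⟨τ, hτ, hθτ, hseg⟩ := exists_split_of_bad (ε := ε) (δ := δ)
      (x₁ := avg c d φ) (x₂ := avg c d fun s => φ s ^ 2)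
      (z₁ := fun τ => avg (d - τ * (d - c)) d φ)
      (z₂ := fun τ => avg (d - τ * (d - c)) d fun s => φ s ^ 2) hεδ hδ
      (continuousOn_avg_right hcd h₁) (continuousOn_avg_right hcd h₂) (by simp) (by simp)
      (fun τ hτ => hsum' τ hτ _ h₁) (fun τ hτ => hsum' τ hτ _ h₂) (hφ c d le_rfl hcd le_rfl)
      (fun τ hτ => ⟨hsq _ _ le_rfl (by nlinarith [hτ.2]) (by nlinarith [hτ.1]),
        hφ _ _ le_rfl (by nlinarith [hτ.2]) (by nlinarith [hτ.1])⟩)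
      (fun τ hτ => hsq _ _ (by nlinarith [hτ.2]) (by nlinarith [hτ.1]) le_rfl)
      ⟨1 - 2 * t, ⟨by linarith, by linarith [ht.1]⟩, by
        refine hbad.le.trans_eq ?_
        rw [← hsum _ hhalf _ h₁, ← hsum _ hhalf _ h₂]
        have e : c + 1 / 2 * (d - c) = d - 1 / 2 * (d - c) := by ring
        simp only [segVar, e]
        ring⟩
    have : 0 < τ * (d - c) := mul_pos hτ.1 hl
    refine ⟨d - τ * (d - c), ⟨by nlinarith [hτ.2], by linarith⟩, ?_, ?_, fun t ht => ?_⟩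
    · nlinarith
    · nlinarith [hτ.2]
    · rw [segVar_symm]
      exact hseg _ ⟨by linarith [ht.2], by linarith [ht.1]⟩

/-- Concavity along the segment of means, evaluated at the parameter `(d - m) / (d - c)` of the
whole interval: the supermartingale step. -/
lemma candidate_split_le {δ c m d : ℝ} {φ : ℝ → ℝ} (hδ : δ < 1) (hcm : c < m) (hmd : m < d)
    (h₁ : IntegrableOn φ (Set.Icc c d)) (h₂ : IntegrableOn (fun s => φ s ^ 2) (Set.Icc c d))
    (hseg : ∀ t ∈ Set.Icc (0 : ℝ) 1, segVar (avg c m φ) (avg c m fun s => φ s ^ 2)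
        (avg m d φ) (avg m d fun s => φ s ^ 2) t < δ ^ 2) :
    (m - c) * candidate δ (avg c m φ) (avg c m fun s => φ s ^ 2) +
      (d - m) * candidate δ (avg m d φ) (avg m d fun s => φ s ^ 2) ≤
      (d - c) * candidate δ (avg c d φ) (avg c d fun s => φ s ^ 2) := by
  have hcd := sub_pos.2 (hcm.trans hmd)
  have hw : (m - c) / (d - c) + (d - m) / (d - c) = 1 := by
    rw [← add_div, show m - c + (d - m) = d - c by ring, div_self hcd.ne']
  have key := (concaveOn_candidate hδ hseg).2 
    (show (0 : ℝ) ∈ Set.Icc 0 1 by simp) (show (1 : ℝ) ∈ Set.Icc 0 1 by simp)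
    (div_nonneg (sub_pos.2 hcm).le hcd.le) (div_nonneg (sub_pos.2 hmd).le hcd.le) hw
  have e : ∀ f : ℝ → ℝ, IntegrableOn f (Set.Icc c d) →
      avg c m f + (d - m) / (d - c) * (avg m d f - avg c m f) = avg c d f := by
    intro f hf
    rw [avg_eq_add hcm hmd hf, eq_sub_of_add_eq hw]
    ring
  simp only [smul_eq_mul, mul_zero, mul_one, zero_add, zero_mul, add_zero, one_mul,
    add_sub_cancel, e _ h₁, e _ h₂] at key
  have := mul_le_mul_of_nonneg_left key hcd.le
  refine le_trans (le_of_eq ?_) this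
  field_simp

/-- Iterated splitting: the martingale of means over finer and finer subintervals. -/
lemma exists_fine_means {a b ε δ δ' : ℝ} {φ : ℝ → ℝ} (hεδ : ε ^ 2 < δ ^ 2) (hδ : 0 < δ)
    (hδδ' : δ < δ') (hδ' : δ' < 1)
    (h₁ : IntegrableOn φ (Set.Icc a b)) (h₂ : IntegrableOn (fun s => φ s ^ 2) (Set.Icc a b))
    (hφ : ∀ c d, a ≤ c → c < d → d ≤ b →
      avg c d (fun s => φ s ^ 2) - avg c d φ ^ 2 ≤ ε ^ 2) (n : ℕ) :
    ∀ c d, a ≤ c → c < d → d ≤ b → ∃ g : ℝ → ℝ≥0∞, Measurable g ∧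
      ∫⁻ s in Set.Icc c d, g s ≤ ENNReal.ofReal
        ((d - c) * candidate δ' (avg c d φ) (avg c d fun s => φ s ^ 2)) ∧
      ∀ s ∈ Set.Icc c d, ∃ c' d', c ≤ c' ∧ c' < d' ∧ d' ≤ d ∧ s ∈ Set.Icc c' d' ∧
        d' - c' ≤ (1 - min (1 / 2) (√(δ ^ 2 - ε ^ 2) / δ)) ^ n * (d - c) ∧
        g s = ENNReal.ofReal (candidate δ' (avg c' d' φ) (avg c' d' fun s => φ s ^ 2)) := by
  have hδ'0 : 0 ≤ δ' := (hδ.trans hδδ').le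
  set θ := √(δ ^ 2 - ε ^ 2) / δ with hθ
  have hθ1 : min (1 / 2) θ ≤ 1 / 2 := min_le_left _ _
  have hnn : ∀ c d, a ≤ c → c < d → d ≤ b →
      0 ≤ candidate δ' (avg c d φ) (avg c d fun s => φ s ^ 2) := fun c d hac hcd hdb =>
    candidate_nonneg hδ'0 hδ' (sq_avg_le hcd (h₁.mono_set (Set.Icc_subset_Icc hac hdb))
      (h₂.mono_set (Set.Icc_subset_Icc hac hdb)))
  induction n with
  | zero =>
    intro c d hac hcd hdb
    refine ⟨fun _ => ENNReal.ofReal (candidate δ' (avg c d φ) (avg c d fun s => φ s ^ 2)),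
      measurable_const, ?_, fun s hs => ⟨c, d, le_rfl, hcd, le_rfl, hs, by simp, rfl⟩⟩
    rw [setLIntegral_const, Real.volume_Icc, mul_comm,
      ← ENNReal.ofReal_mul (sub_pos.2 hcd).le]
  | succ n ih =>
    intro c d hac hcd hdb
    have hs := Set.Icc_subset_Icc hac hdb
    obtain ⟨m, ⟨hcm, hmd⟩, hm1, hm2, hseg⟩ := exists_split hεδ hδ hcd (h₁.mono_set hs)
      (h₂.mono_set hs) fun c' d' h h' h'' => hφ c' d' (hac.trans h) h' (h''.trans hdb)
    obtain ⟨g₁, hg₁, hi₁, hp₁⟩ := ih c m hac hcm (hmd.le.trans hdb)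
    obtain ⟨g₂, hg₂, hi₂, hp₂⟩ := ih m d (hac.trans hcm.le) hmd hdb
    have hq : 0 ≤ (1 - min (1 / 2) θ) ^ n := pow_nonneg (by linarith) n
    refine ⟨fun s => if s ≤ m then g₁ s else g₂ s,
      Measurable.ite measurableSet_Iic hg₁ hg₂, ?_, ?_⟩
    · have hlt : ∀ t ∈ Set.Icc (0 : ℝ) 1, segVar (avg c m φ) (avg c m fun s => φ s ^ 2)
          (avg m d φ) (avg m d fun s => φ s ^ 2) t < δ' ^ 2 := fun t ht =>
        (hseg t ht).trans_lt (by gcongr)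
      rw [← Set.Icc_union_Ioc_eq_Icc hcm.le hmd.le]
      refine (lintegral_union_le _ _ _).trans ?_
      have e₁ : ∫⁻ s in Set.Icc c m, (if s ≤ m then g₁ s else g₂ s) =
          ∫⁻ s in Set.Icc c m, g₁ s :=
        setLIntegral_congr_fun measurableSet_Icc fun s hs => if_pos hs.2
      have e₂ : ∫⁻ s in Set.Ioc m d, (if s ≤ m then g₁ s else g₂ s) =
          ∫⁻ s in Set.Ioc m d, g₂ s :=
        setLIntegral_congr_fun measurableSet_Ioc fun s hs => if_neg (not_le.2 hs.1)
      rw [e₁, e₂]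
      refine (add_le_add hi₁ ((lintegral_mono_set Set.Ioc_subset_Icc_self).trans hi₂)).trans ?_
      rw [← ENNReal.ofReal_add
        (mul_nonneg (sub_pos.2 hcm).le (hnn _ _ hac hcm (hmd.le.trans hdb)))
        (mul_nonneg (sub_pos.2 hmd).le (hnn _ _ (hac.trans hcm.le) hmd hdb))]
      exact ENNReal.ofReal_le_ofReal
        (candidate_split_le hδ' hcm hmd (h₁.mono_set hs) (h₂.mono_set hs) hlt)
    · intro s hs
      by_cases hsm : s ≤ m
      · obtain ⟨c', d', h1, h2, h3, h4, h5, h6⟩ := hp₁ s ⟨hs.1, hsm⟩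
        refine ⟨c', d', h1, h2, h3.trans hmd.le, h4, h5.trans ?_, ?_⟩
        · rw [pow_succ, mul_assoc]
          exact mul_le_mul_of_nonneg_left hm1 hq
        · simpa only [if_pos hsm] using h6
      · obtain ⟨c', d', h1, h2, h3, h4, h5, h6⟩ := hp₂ s ⟨(not_le.1 hsm).le, hs.2⟩
        refine ⟨c', d', hcm.le.trans h1, h2, h3, h4, h5.trans ?_, ?_⟩
        · rw [pow_succ, mul_assoc]
          exact mul_le_mul_of_nonneg_left hm2 hq
        · simpa only [if_neg hsm] using h6

/-- Lebesgue differentiation along shrinking intervals which contain the point. -/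
lemma ae_tendsto_avg {a b : ℝ} {f : ℝ → ℝ} (hf : IntegrableOn f (Set.Icc a b)) :
    ∀ᵐ s, s ∈ Set.Icc a b → ∀ c d : ℕ → ℝ, (∀ n, a ≤ c n) → (∀ n, c n < d n) →
      (∀ n, d n ≤ b) → (∀ n, s ∈ Set.Icc (c n) (d n)) →
      Filter.Tendsto (fun n => d n - c n) Filter.atTop (nhds 0) →
      Filter.Tendsto (fun n => avg (c n) (d n) f) Filter.atTop (nhds (f s)) := by
  have hF : LocallyIntegrable ((Set.Icc a b).indicator f) volume :=
    (hf.integrable_indicator measurableSet_Icc).locallyIntegrable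
  -- The intervals are balls about their own midpoints, not about `s`. The constant `1` allows `s`
  -- anywhere in the ball.
  filter_upwards [IsUnifLocDoublingMeasure.ae_tendsto_average (μ := volume) hF 1] with s hs
    hsab c d hac hcd hdb hmem hlim
  have hball : ∀ n, Metric.closedBall ((c n + d n) / 2) ((d n - c n) / 2) =
      Set.Icc (c n) (d n) := fun n => (Real.Icc_eq_closedBall _ _).symm
  have := hs (l := Filter.atTop) (fun n => (c n + d n) / 2) (fun n => (d n - c n) / 2)
    (tendsto_nhdsWithin_iff.2 ⟨by simpa using hlim.div_const 2,
      Filter.Eventually.of_forall fun n => by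
        have := hcd n
        simp only [Set.mem_Ioi]; linarith⟩)
    (Filter.Eventually.of_forall fun n => by rw [one_mul, hball]; exact hmem n)
  rw [Set.indicator_of_mem hsab] at this
  refine this.congr fun n => ?_
  rw [hball, avg]
  exact setAverage_congr_fun measurableSet_Icc (Filter.Eventually.of_forall fun x hx =>
    Set.indicator_of_mem (Set.Icc_subset_Icc (hac n) (hdb n) hx) f)

lemma expAvg_le_candidate_of_lt {a b ε δ : ℝ} (hab : a < b) (hε : 0 < ε) (hεδ : ε < δ)
    (hδ : δ < 1) {φ : ℝ → ℝ} (hφ : φ ∈ bmoBall a b ε) :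
    expAvg a b φ ≤ ENNReal.ofReal (candidate δ (avg a b φ) (avg a b fun s => φ s ^ 2)) := by
  obtain ⟨h₁, h₂, hosc⟩ := (mem_bmoBall_iff hab hε.le).1 hφ
  have hδ0 : 0 < δ := hε.trans hεδ
  -- Two gaps are needed: `ε < η` bounds the splitting ratio, and `η < δ` turns the closed strip of
  -- `exists_split` into the open one that concavity requires.
  obtain ⟨η, hεη, hηδ⟩ := exists_between hεδ
  have hη0 : 0 < η := hε.trans hεη
  have hsq : ε ^ 2 < η ^ 2 := by gcongr
  choose g hg hint hp using fun n =>
    exists_fine_means hsq hη0 hηδ hδ h₁ h₂ hosc n a b le_rfl hab le_rfl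
  set q := 1 - min (1 / 2) (√(η ^ 2 - ε ^ 2) / η) with hq
  have hθ : 0 < min (1 / 2) (√(η ^ 2 - ε ^ 2) / η) :=
    lt_min (by norm_num) (div_pos (Real.sqrt_pos.2 (sub_pos.2 hsq)) hη0)
  have hq0 : 0 ≤ q := by
    have : min (1 / 2) (√(η ^ 2 - ε ^ 2) / η) ≤ 1 / 2 := min_le_left _ _
    linarith
  have hq1 : q < 1 := by linarith
  have hlim : Filter.Tendsto (fun n : ℕ => q ^ n * (b - a)) Filter.atTop (nhds 0) := by
    simpa using (tendsto_pow_atTop_nhds_zero_of_lt_one hq0 hq1).mul_const (b - a)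
  have hae : ∀ᵐ s, s ∈ Set.Icc a b →
      ENNReal.ofReal (Real.exp (φ s)) = Filter.liminf (fun n => g n s) Filter.atTop := by
    filter_upwards [ae_tendsto_avg h₁, ae_tendsto_avg h₂] with s hs₁ hs₂ hs
    choose c d hac hcd hdb hmem hlen hval using fun n => hp n s hs
    have hlim' : Filter.Tendsto (fun n => d n - c n) Filter.atTop (nhds 0) :=
      squeeze_zero (fun n => (sub_pos.2 (hcd n)).le) hlen hlim
    have t₁ := hs₁ hs c d hac hcd hdb hmem hlim'
    have t₂ := hs₂ hs c d hac hcd hdb hmem hlim'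
    have t := ENNReal.tendsto_ofReal
      (((continuous_candidate δ).tendsto (φ s, φ s ^ 2)).comp (t₁.prodMk_nhds t₂))
    simp only [candidate_self hδ0.le hδ] at t
    exact (t.congr fun n => (hval n).symm).liminf_eq.symm
  rw [expAvg, laverage_Icc_eq, setLIntegral_congr_fun_ae measurableSet_Icc hae]
  refine ENNReal.div_le_of_le_mul ?_
  -- Fatou rather than dominated convergence: integrability of `exp φ` is a conclusion here.
  refine (lintegral_liminf_le hg).trans ?_
  refine Filter.liminf_le_of_frequently_le' (Filter.Frequently.of_forall fun n => ?_)
  refine (hint n).trans_eq ?_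
  rw [ENNReal.ofReal_mul (sub_pos.2 hab).le, mul_comm]

lemma expAvg_le_candidate {a b ε : ℝ} (hab : a < b) (hε : 0 < ε) (hε1 : ε < 1) {φ : ℝ → ℝ}
    (hφ : φ ∈ bmoBall a b ε) :
    expAvg a b φ ≤ ENNReal.ofReal (candidate ε (avg a b φ) (avg a b fun s => φ s ^ 2)) := by
  have hc : ContinuousAt (fun δ => candidate δ (avg a b φ) (avg a b fun s => φ s ^ 2)) ε := by
    have : (1 : ℝ) - ε ≠ 0 := by linarith
    unfold candidate
    refine ContinuousAt.mul (ContinuousAt.div (by fun_prop) (by fun_prop) this) (by fun_prop)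
  refine ge_of_tendsto (ENNReal.tendsto_ofReal (hc.tendsto.mono_left
    (nhdsWithin_le_nhds (s := Set.Ioi ε)))) ?_
  filter_upwards [Ioo_mem_nhdsGT hε1] with δ hδ
  exact expAvg_le_candidate_of_lt hab hε hδ.1 hδ.2 hφ

/-! ### The truncated logarithm: oscillation and moments -/

/-- An antiderivative of `(log s - m) ^ 2`, continuous up to `0`. -/
lemma integral_log_sub_const_sq {c d : ℝ} (hc : 0 ≤ c) (hcd : c < d) (m : ℝ) :
    IntervalIntegrable (fun s => (Real.log s - m) ^ 2) volume c d ∧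
    ∫ s in c..d, (Real.log s - m) ^ 2 =
      d * ((Real.log d - m - 1) ^ 2 + 1) - c * ((Real.log c - m - 1) ^ 2 + 1) := by
  have hcont : ContinuousOn (fun s => s * ((Real.log s - m - 1) ^ 2 + 1)) (Set.Icc c d) := by
    -- Continuity at `0` comes from `s log² s = 4 (√s log √s)²` for `s ≥ 0` and the continuity of `s
    -- log s`.
    have hc' : Continuous fun s : ℝ => 4 * (√s * Real.log √s) ^ 2 -
        2 * (m + 1) * (s * Real.log s) + ((m + 1) ^ 2 + 1) * s := by
      have h1 := Real.continuous_mul_log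
      have h2 := h1.comp Real.continuous_sqrt
      simp only [Function.comp_def] at h2
      fun_prop
    refine hc'.continuousOn.congr fun s hs => ?_
    have hs0 : 0 ≤ s := hc.trans hs.1
    simp only [mul_pow, Real.sq_sqrt hs0, Real.log_sqrt hs0]
    ring
  have hderiv : ∀ s ∈ Set.Ioo c d, HasDerivAt (fun s => s * ((Real.log s - m - 1) ^ 2 + 1))
      ((Real.log s - m) ^ 2) s := by
    intro s hs
    have hs0 : s ≠ 0 := (hc.trans_lt hs.1).ne'
    refine ((hasDerivAt_id s).mul (((((Real.hasDerivAt_log hs0).sub_const m).sub_const 1).pow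
      2).add_const 1)).congr_deriv ?_
    simp only [id, Pi.pow_apply]
    field_simp
    push_cast
    ring
  have hi : IntervalIntegrable (fun s => (Real.log s - m) ^ 2) volume c d := by
    refine intervalIntegral.intervalIntegrable_deriv_of_nonneg (by rwa [Set.uIcc_of_le hcd.le])
      (fun s hs => hderiv s ?_) fun s _ => sq_nonneg _
    rwa [min_eq_left hcd.le, max_eq_right hcd.le] at hs
  exact ⟨hi, intervalIntegral.integral_eq_sub_of_hasDerivAt_of_le hcd.le hcont hderiv hi⟩

/-- The positive part of the logarithm `log (A / (s - a))`. -/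
noncomputable def logCut (a A s : ℝ) : ℝ := max (Real.log A - Real.log (s - a)) 0

lemma logCut_of_le {a A s : ℝ} (hs : a < s) (h : s ≤ a + A) :
    logCut a A s = Real.log A - Real.log (s - a) :=
  max_eq_left (sub_nonneg.2 (Real.log_le_log (sub_pos.2 hs) (by linarith)))

lemma logCut_of_ge {a A s : ℝ} (hA : 0 < A) (h : a + A ≤ s) : logCut a A s = 0 :=
  max_eq_right (sub_nonpos.2 (Real.log_le_log hA (by linarith)))

lemma measurable_logCut (a A : ℝ) : Measurable (logCut a A) := by
  unfold logCut; fun_prop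

lemma integral_log_shift_sq {a c d : ℝ} (hac : a ≤ c) (hcd : c < d) (m : ℝ) :
    IntervalIntegrable (fun s => (Real.log (s - a) - m) ^ 2) volume c d ∧
    ∫ s in c..d, (Real.log (s - a) - m) ^ 2 =
      (d - a) * ((Real.log (d - a) - m - 1) ^ 2 + 1) -
        (c - a) * ((Real.log (c - a) - m - 1) ^ 2 + 1) := by
  obtain ⟨h1, h2⟩ := integral_log_sub_const_sq (c := c - a) (d := d - a) (by linarith)
    (by linarith) m
  refine ⟨by simpa using h1.comp_sub_right a, ?_⟩
  rw [← h2, ← intervalIntegral.integral_comp_sub_right (fun s => (Real.log s - m) ^ 2) a]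

lemma integrableOn_logCut_sq {a b : ℝ} (hab : a < b) (A : ℝ) :
    IntegrableOn (fun s => logCut a A s ^ 2) (Set.Icc a b) := by
  have h := (intervalIntegrable_iff_integrableOn_Icc_of_le hab.le).1
    (integral_log_shift_sq le_rfl hab (Real.log A)).1
  refine h.mono' ((measurable_logCut a A).pow_const 2).aestronglyMeasurable
    (ae_of_all _ fun s => ?_)
  rw [Real.norm_of_nonneg (sq_nonneg _), sq_le_sq, abs_sub_comm (Real.log (s - a)), logCut,
    abs_of_nonneg (le_max_right _ _)]
  exact max_le (le_abs_self _) (abs_nonneg _)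

lemma integrableOn_logCut {a b : ℝ} (hab : a < b) (A : ℝ) :
    IntegrableOn (logCut a A) (Set.Icc a b) := by
  refine ((integrableOn_logCut_sq hab A).add (integrableOn_const (C := (1 : ℝ)) (by simp))).mono'
    (measurable_logCut a A).aestronglyMeasurable (ae_of_all _ fun s => ?_)
  have h0 : 0 ≤ logCut a A s := le_max_right _ _
  rw [Real.norm_of_nonneg h0]
  simp only [Pi.add_apply]
  nlinarith [sq_nonneg (logCut a A s - 1)]

/-- The variance is at most the mean square deviation from any constant, and truncation by `max · 0`
is 1-Lipschitz, so the pure logarithm suffices. Its deviation is taken from `log (d - a) - 1`, its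
mean over `[a, d]`: then the antiderivative equals exactly `d - a` at `d` and is at least `c - a` at
`c`. -/
lemma avg_logCut_sq_sub_le {a c d : ℝ} (hac : a ≤ c) (hcd : c < d) (A : ℝ) :
    avg c d (fun s => logCut a A s ^ 2) - avg c d (logCut a A) ^ 2 ≤ 1 := by
  have hs : Set.Icc c d ⊆ Set.Icc a d := Set.Icc_subset_Icc hac le_rfl
  have had := hac.trans_lt hcd
  have h₁ := (integrableOn_logCut had A).mono_set hs
  have h₂ := (integrableOn_logCut_sq had A).mono_set hs
  set m := Real.log (d - a) - 1 with hm
  set k := max (Real.log A - m) 0 with hk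
  have e := avg_sub_const_sq hcd h₁ h₂ k
  suffices h : avg c d (fun s => (logCut a A s - k) ^ 2) ≤ 1 by
    nlinarith [sq_nonneg (avg c d (logCut a A) - k)]
  obtain ⟨hi, hv⟩ := integral_log_shift_sq hac hcd m
  rw [avg_eq hcd, div_le_one (sub_pos.2 hcd)]
  calc ∫ s in c..d, (logCut a A s - k) ^ 2 ≤ ∫ s in c..d, (Real.log (s - a) - m) ^ 2 := by
        refine intervalIntegral.integral_mono_on hcd.le
          ((intervalIntegrable_iff_integrableOn_Icc_of_le hcd.le).2
            (integrableOn_sub_const_sq h₁ h₂ k)) hi fun s _ => ?_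
        rw [sq_le_sq, logCut, hk]
        refine (abs_max_sub_max_le_abs _ _ _).trans_eq ?_
        rw [sub_sub_sub_cancel_left, abs_sub_comm]
    _ ≤ d - c := by
        rw [hv, hm]
        have : 0 ≤ (c - a) * (Real.log (c - a) - (Real.log (d - a) - 1) - 1) ^ 2 :=
          mul_nonneg (by linarith) (sq_nonneg _)
        nlinarith

lemma integral_logCut_pow {a b A : ℝ} (hA : 0 < A) (hAb : a + A ≤ b) {n : ℕ} (hn : n ≠ 0)
    (hi : IntegrableOn (fun s => logCut a A s ^ n) (Set.Icc a b)) :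
    ∫ s in a..b, logCut a A s ^ n = ∫ s in a..(a + A), (Real.log A - Real.log (s - a)) ^ n := by
  have haA : a ≤ a + A := by linarith
  have i₁ : IntervalIntegrable (fun s => logCut a A s ^ n) volume a (a + A) :=
    (intervalIntegrable_iff_integrableOn_Icc_of_le haA).2
      (hi.mono_set (Set.Icc_subset_Icc le_rfl hAb))
  have i₂ : IntervalIntegrable (fun s => logCut a A s ^ n) volume (a + A) b :=
    (intervalIntegrable_iff_integrableOn_Icc_of_le hAb).2
      (hi.mono_set (Set.Icc_subset_Icc haA le_rfl))
  rw [← intervalIntegral.integral_add_adjacent_intervals i₁ i₂]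
  have e₂ : ∫ s in (a + A)..b, logCut a A s ^ n = 0 := by
    refine (intervalIntegral.integral_congr fun s hs => ?_).trans intervalIntegral.integral_zero
    rw [Set.uIcc_of_le hAb] at hs
    simp only [logCut_of_ge hA hs.1, zero_pow hn]
  rw [e₂, add_zero]
  refine intervalIntegral.integral_congr_ae (ae_of_all _ fun s hs => ?_)
  rw [Set.uIoc_of_le haA] at hs
  rw [logCut_of_le hs.1 hs.2]

lemma avg_logCut {a b A : ℝ} (hA : 0 < A) (hAb : a + A ≤ b) :
    avg a b (logCut a A) = A / (b - a) := by
  have hab : a < b := by linarith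
  rw [avg_eq hab]
  have h := integral_logCut_pow hA hAb one_ne_zero (by simpa using integrableOn_logCut hab A)
  simp only [pow_one] at h
  rw [h, intervalIntegral.integral_comp_sub_right (fun s => Real.log A - Real.log s) a,
    intervalIntegral.integral_sub intervalIntegrable_const
      intervalIntegral.intervalIntegrable_log', integral_log]
  simp

lemma avg_logCut_sq {a b A : ℝ} (hA : 0 < A) (hAb : a + A ≤ b) :
    avg a b (fun s => logCut a A s ^ 2) = 2 * A / (b - a) := by
  have hab : a < b := by linarith
  rw [avg_eq hab, integral_logCut_pow hA hAb two_ne_zero (integrableOn_logCut_sq hab A)]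
  simp only [sub_sq_comm (Real.log A)]
  rw [(integral_log_shift_sq le_rfl (by linarith : a < a + A) (Real.log A)).2]
  simp
  ring

lemma avg_affine {c d : ℝ} (hcd : c < d) {f g : ℝ → ℝ} (hf : IntegrableOn f (Set.Icc c d))
    (hg : IntegrableOn g (Set.Icc c d)) (p q r : ℝ) :
    avg c d (fun s => p + q * f s + r * g s) = p + q * avg c d f + r * avg c d g := by
  have i₁ : IntervalIntegrable f volume c d :=
    (intervalIntegrable_iff_integrableOn_Icc_of_le hcd.le).2 hf
  have i₂ : IntervalIntegrable g volume c d :=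
    (intervalIntegrable_iff_integrableOn_Icc_of_le hcd.le).2 hg
  have h0 : d - c ≠ 0 := (sub_pos.2 hcd).ne'
  rw [avg_eq hcd, avg_eq hcd, avg_eq hcd, intervalIntegral.integral_add
    (intervalIntegrable_const.add (i₁.const_mul q)) (i₂.const_mul r),
    intervalIntegral.integral_add intervalIntegrable_const (i₁.const_mul q),
    intervalIntegral.integral_const, intervalIntegral.integral_const_mul,
    intervalIntegral.integral_const_mul, smul_eq_mul]
  field_simp

/-! ### Extremal functions and the lower bound -/

/-- The extremal function, with mean `u + ε A / (b - a)`. -/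
noncomputable def extremal (a A u ε s : ℝ) : ℝ := u + ε * logCut a A s

/-- The vanishing quadratic term puts the function in the form required by `avg_affine`. -/
lemma extremal_eq (a A u ε : ℝ) :
    extremal a A u ε = fun s => u + ε * logCut a A s + 0 * logCut a A s ^ 2 := by
  funext s; rw [extremal]; ring

lemma extremal_sq_eq (a A u ε : ℝ) :
    (fun s => extremal a A u ε s ^ 2) =
      fun s => u ^ 2 + 2 * u * ε * logCut a A s + ε ^ 2 * logCut a A s ^ 2 := by
  funext s; rw [extremal]; ring

lemma avg_extremal {a c d : ℝ} (hac : a ≤ c) (hcd : c < d) (A u ε : ℝ) :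
    avg c d (extremal a A u ε) = u + ε * avg c d (logCut a A) ∧
    avg c d (fun s => extremal a A u ε s ^ 2) = u ^ 2 + 2 * u * ε * avg c d (logCut a A) +
      ε ^ 2 * avg c d (fun s => logCut a A s ^ 2) := by
  have had := hac.trans_lt hcd
  have hs : Set.Icc c d ⊆ Set.Icc a d := Set.Icc_subset_Icc hac le_rfl
  have h₁ := (integrableOn_logCut had A).mono_set hs
  have h₂ := (integrableOn_logCut_sq had A).mono_set hs
  rw [extremal_sq_eq, avg_affine hcd h₁ h₂, extremal_eq, avg_affine hcd h₁ h₂]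
  exact ⟨by ring, rfl⟩

lemma extremal_mem_bmoBall {a b ε : ℝ} (hab : a < b) (hε : 0 ≤ ε) (A u : ℝ) :
    extremal a A u ε ∈ bmoBall a b ε := by
  have h₁ := integrableOn_logCut hab A
  have h₂ := integrableOn_logCut_sq hab A
  refine (mem_bmoBall_iff hab hε).2 ⟨?_, ?_, fun c d hac hcd hdb => ?_⟩
  · exact (integrableOn_const (by simp)).add (h₁.const_mul ε)
  · rw [extremal_sq_eq]
    exact ((integrableOn_const (by simp)).add (h₁.const_mul _)).add (h₂.const_mul _)
  · obtain ⟨e₁, e₂⟩ := avg_extremal hac hcd A u ε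
    rw [e₁, e₂]
    nlinarith [mul_le_mul_of_nonneg_left (avg_logCut_sq_sub_le hac hcd A) (sq_nonneg ε)]

lemma exp_extremal_of_le {a A s : ℝ} (hA : 0 < A) (hs : a < s) (h : s ≤ a + A) (u ε : ℝ) :
    Real.exp (extremal a A u ε s) = Real.exp u * A ^ ε * (s - a) ^ (-ε) := by
  have hs' := sub_pos.2 hs
  rw [extremal, logCut_of_le hs h, Real.rpow_def_of_pos hA, Real.rpow_def_of_pos hs',
    ← Real.exp_add, ← Real.exp_add]
  congr 1
  ring

lemma measurable_extremal (a A u ε : ℝ) : Measurable (extremal a A u ε) :=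
  measurable_const.add ((measurable_logCut a A).const_mul ε)

lemma expAvg_extremal {a b A ε : ℝ} (hA : 0 < A) (hAb : a + A ≤ b) (hε1 : ε < 1) (u : ℝ) :
    expAvg a b (extremal a A u ε) =
      ENNReal.ofReal (Real.exp u * (A / (1 - ε) + (b - a - A)) / (b - a)) := by
  have hab : a < b := by linarith
  have haA : a ≤ a + A := by linarith
  have i₀ : IntervalIntegrable (fun s => Real.exp u * A ^ ε * (s - a) ^ (-ε))
      volume a (a + A) := by
    have := (intervalIntegral.intervalIntegrable_rpow' (a := 0) (b := A)
      (show -1 < -ε by linarith)).comp_sub_right a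
    simp only [zero_add] at this
    rw [add_comm a A]
    exact this.const_mul _
  have i₁ : IntervalIntegrable (fun s => Real.exp (extremal a A u ε s)) volume a (a + A) :=
    i₀.congr fun s hs => by
      rw [Set.uIoc_of_le haA] at hs
      exact (exp_extremal_of_le hA hs.1 hs.2 u ε).symm
  have e₂ : ∀ s ∈ Set.uIcc (a + A) b, Real.exp (extremal a A u ε s) = Real.exp u := by
    intro s hs
    rw [Set.uIcc_of_le hAb] at hs
    rw [extremal, logCut_of_ge hA hs.1, mul_zero, add_zero]
  have i₂ : IntervalIntegrable (fun s => Real.exp (extremal a A u ε s)) volume (a + A) b :=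
    (intervalIntegrable_const (c := Real.exp u)).congr fun s hs =>
      (e₂ s (Set.uIoc_subset_uIcc hs)).symm
  have hi := (intervalIntegrable_iff_integrableOn_Icc_of_le hab.le).1 (i₁.trans i₂)
  rw [expAvg, laverage_Icc_eq, ← ofReal_integral_eq_lintegral_ofReal hi
    (ae_of_all _ fun s => (Real.exp_pos _).le), ← ENNReal.ofReal_div_of_pos (sub_pos.2 hab),
    integral_Icc_eq_integral_Ioc, ← intervalIntegral.integral_of_le hab.le,
    ← intervalIntegral.integral_add_adjacent_intervals i₁ i₂,
    intervalIntegral.integral_congr e₂, intervalIntegral.integral_const]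
  have e₁ : ∫ s in a..(a + A), Real.exp (extremal a A u ε s) =
      ∫ s in a..(a + A), Real.exp u * A ^ ε * (s - a) ^ (-ε) := by
    refine intervalIntegral.integral_congr_ae (ae_of_all _ fun s hs => ?_)
    rw [Set.uIoc_of_le haA] at hs
    exact exp_extremal_of_le hA hs.1 hs.2 u ε
  have hpow : A ^ ε * A ^ (-ε + 1) = A := by
    rw [← Real.rpow_add hA, add_neg_cancel_left, Real.rpow_one]
  have h0 : -ε + 1 ≠ 0 := by linarith
  rw [e₁, intervalIntegral.integral_const_mul,
    intervalIntegral.integral_comp_sub_right (fun s => s ^ (-ε)) a,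
    integral_rpow (Or.inl (by linarith)), sub_self, add_sub_cancel_left, Real.zero_rpow h0,
    sub_zero, mul_assoc, ← mul_div_assoc, hpow, smul_eq_mul]
  congr 2
  rw [show -ε + 1 = 1 - ε by ring]
  ring

/-- On `(a, a + A]` the exponential is a positive multiple of `(s - a) ^ (-ε)`, which is integrable
at `a` only if `ε < 1`. -/
lemma expAvg_extremal_eq_top {a b A ε : ℝ} (hA : 0 < A) (hAb : a + A ≤ b) (hε1 : 1 ≤ ε) (u : ℝ) :
    expAvg a b (extremal a A u ε) = ⊤ := by
  have hab : a < b := by linarith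
  rw [expAvg, laverage_Icc_eq]
  suffices h : ∫⁻ s in Set.Icc a b, ENNReal.ofReal (Real.exp (extremal a A u ε s)) = ⊤ by
    rw [h, ENNReal.top_div_of_ne_top ENNReal.ofReal_ne_top]
  by_contra hne
  have hi : IntegrableOn (fun s => Real.exp (extremal a A u ε s)) (Set.Icc a b) := by
    refine ⟨(Real.measurable_exp.comp (measurable_extremal a A u ε)).aestronglyMeasurable, ?_⟩
    rw [hasFiniteIntegral_iff_ofReal (ae_of_all _ fun s => (Real.exp_pos _).le)]
    exact lt_top_iff_ne_top.2 hne
  have haA : a ≤ a + A := by linarith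
  have i₁ : IntervalIntegrable (fun s => Real.exp (extremal a A u ε s)) volume a (a + A) :=
    (intervalIntegrable_iff_integrableOn_Icc_of_le haA).2
      (hi.mono_set (Set.Icc_subset_Icc le_rfl hAb))
  have hC : Real.exp u * A ^ ε ≠ 0 := (mul_pos (Real.exp_pos _) (Real.rpow_pos_of_pos hA _)).ne'
  have i₂ : IntervalIntegrable (fun s => (s - a) ^ (-ε)) volume a (a + A) := by
    refine (i₁.const_mul (Real.exp u * A ^ ε)⁻¹).congr fun s hs => ?_
    rw [Set.uIoc_of_le haA] at hs
    simp only [exp_extremal_of_le hA hs.1 hs.2 u ε, inv_mul_cancel_left₀ hC]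
  have i₃ := i₂.comp_add_right a
  simp only [add_sub_cancel_right, sub_self, add_sub_cancel_left] at i₃
  rw [intervalIntegrable_iff_integrableOn_Ioo_of_le hA.le,
    intervalIntegral.integrableOn_Ioo_rpow_iff hA] at i₃
  linarith

lemma avg_const {c d : ℝ} (hcd : c < d) (k : ℝ) : avg c d (fun _ => k) = k := by
  rw [avg_eq hcd, intervalIntegral.integral_const, smul_eq_mul,
    mul_div_cancel_left₀ _ (sub_pos.2 hcd).ne']

lemma expAvg_const {a b : ℝ} (hab : a < b) (k : ℝ) :
    expAvg a b (fun _ => k) = ENNReal.ofReal (Real.exp k) := by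
  rw [expAvg, laverage_Icc_eq, setLIntegral_const, Real.volume_Icc,
    ENNReal.mul_div_cancel_right (by simpa using hab) ENNReal.ofReal_ne_top]

lemma const_mem_bmoBall {a b ε : ℝ} (hab : a < b) (hε : 0 ≤ ε) (k : ℝ) :
    (fun _ => k) ∈ bmoBall a b ε := by
  refine (mem_bmoBall_iff hab hε).2 ⟨integrableOn_const (by simp), integrableOn_const (by simp),
    fun c d _ hcd _ => ?_⟩
  rw [avg_const hcd, avg_const hcd, sub_self]
  positivity

lemma le_bellman {a b ε : ℝ} {x : ℝ × ℝ} {φ : ℝ → ℝ} (hφ : φ ∈ bmoBall a b ε)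
    (h₁ : avg a b φ = x.1) (h₂ : avg a b (fun s => φ s ^ 2) = x.2) :
    expAvg a b φ ≤ bellman a b ε x :=
  le_sSup ⟨φ, ⟨hφ, h₁, h₂⟩, rfl⟩

lemma le_bellman_lower_boundary {a b ε : ℝ} (hab : a < b) (hε : 0 ≤ ε) {x : ℝ × ℝ}
    (hx : x.2 = x.1 ^ 2) : ENNReal.ofReal (Real.exp x.1) ≤ bellman a b ε x := by
  rw [← expAvg_const hab]
  exact le_bellman (const_mem_bmoBall hab hε x.1) (avg_const hab _) (by rw [avg_const hab, hx])

lemma expAvg_eq_of_avg_sq_eq {a b : ℝ} (hab : a < b) {φ : ℝ → ℝ} {k : ℝ}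
    (h₁ : IntegrableOn φ (Set.Icc a b)) (h₂ : IntegrableOn (fun s => φ s ^ 2) (Set.Icc a b))
    (e₁ : avg a b φ = k) (e₂ : avg a b (fun s => φ s ^ 2) = k ^ 2) :
    expAvg a b φ = ENNReal.ofReal (Real.exp k) := by
  have h := avg_sub_const_sq hab h₁ h₂ k
  have h0 : ∫ s in Set.Icc a b, (φ s - k) ^ 2 = 0 := by
    rw [e₁, e₂, avg, setAverage_eq, Real.volume_real_Icc_of_le hab.le, smul_eq_mul] at h
    have hne : (b - a)⁻¹ ≠ 0 := inv_ne_zero (sub_pos.2 hab).ne'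
    exact (mul_eq_zero.1 (h.trans (by ring))).resolve_left hne
  have hae := (setIntegral_eq_zero_iff_of_nonneg_ae (ae_of_all _ fun s => sq_nonneg _)
    (integrableOn_sub_const_sq h₁ h₂ k)).1 h0
  rw [← expAvg_const hab, expAvg, expAvg]
  refine laverage_congr ?_
  filter_upwards [hae] with s hs
  have : φ s - k = 0 := pow_eq_zero_iff two_ne_zero |>.1 hs
  rw [sub_eq_zero.1 this]

/-- The extremal function at a point above the lower boundary. -/
lemma exists_extremal {a b ε : ℝ} (hab : a < b) (hε : 0 < ε) {x : ℝ × ℝ} (hx : x ∈ Omega ε)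
    (hlt : x.1 ^ 2 < x.2) :
    ∃ A u, 0 < A ∧ a + A ≤ b ∧ A = (1 - √(ε ^ 2 - x.2 + x.1 ^ 2) / ε) * (b - a) ∧
      u = x.1 + √(ε ^ 2 - x.2 + x.1 ^ 2) - ε ∧
      avg a b (extremal a A u ε) = x.1 ∧ avg a b (fun s => extremal a A u ε s ^ 2) = x.2 := by
  have hr2 : √(ε ^ 2 - x.2 + x.1 ^ 2) ^ 2 = ε ^ 2 - x.2 + x.1 ^ 2 :=
    Real.sq_sqrt (by linarith [hx.2])
  have hr0 := Real.sqrt_nonneg (ε ^ 2 - x.2 + x.1 ^ 2)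
  generalize √(ε ^ 2 - x.2 + x.1 ^ 2) = r at *
  have hl := sub_pos.2 hab
  have hrε : r < ε := lt_of_pow_lt_pow_left₀ 2 hε.le (by linarith)
  have h1 : 0 < 1 - r / ε := by rw [sub_pos, div_lt_one hε]; exact hrε
  have hA : 0 < (1 - r / ε) * (b - a) := mul_pos h1 hl
  have hAb : a + (1 - r / ε) * (b - a) ≤ b := by
    have : 0 ≤ r / ε * (b - a) := by positivity
    linarith
  -- With `α = A / (b - a)` the mean is `u + εα` and the variance is `ε² (2α - α²) = ε² - ε² (1 -
  -- α)²`. Matching this with `x₂ - x₁² = ε² - r²` gives `α = 1 - r / ε` and `u = x₁ + r - ε`.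
  refine ⟨_, _, hA, hAb, rfl, rfl, ?_, ?_⟩
  · rw [(avg_extremal le_rfl hab _ _ _).1, avg_logCut hA hAb, mul_div_cancel_right₀ _ hl.ne']
    field_simp
    ring
  · rw [(avg_extremal le_rfl hab _ _ _).2, avg_logCut hA hAb, avg_logCut_sq hA hAb, ← mul_assoc,
      mul_div_cancel_right₀ _ hl.ne', mul_div_cancel_right₀ _ hl.ne']
    field_simp
    linear_combination -hr2

end JohnNirenberg

theorem mainTheorem2 (a b : ℝ) (hab : a < b) (ε : ℝ) (hε : 0 < ε)
    (x : ℝ × ℝ) (hx : x ∈ JohnNirenberg.Omega ε) :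
    (ε < 1 → JohnNirenberg.bellman a b ε x =
      ENNReal.ofReal ((1 - Real.sqrt (ε ^ 2 - x.2 + x.1 ^ 2)) / (1 - ε) *
        Real.exp (x.1 + Real.sqrt (ε ^ 2 - x.2 + x.1 ^ 2) - ε))) ∧
    (1 ≤ ε → x.1 ^ 2 < x.2 → JohnNirenberg.bellman a b ε x = ⊤) ∧
    (1 ≤ ε → x.2 = x.1 ^ 2 →
      JohnNirenberg.bellman a b ε x = ENNReal.ofReal (Real.exp x.1)) := by
  have hl := sub_pos.2 hab
  have hbdry : x.2 = x.1 ^ 2 →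
      JohnNirenberg.bellman a b ε x = ENNReal.ofReal (Real.exp x.1) := by
    refine fun h => le_antisymm (sSup_le ?_)
      (JohnNirenberg.le_bellman_lower_boundary hab hε.le h)
    rintro _ ⟨φ, ⟨hφ, e₁, e₂⟩, rfl⟩
    obtain ⟨h₁, h₂, -⟩ := (JohnNirenberg.mem_bmoBall_iff hab hε.le).1 hφ
    exact (JohnNirenberg.expAvg_eq_of_avg_sq_eq hab h₁ h₂ e₁ (e₂.trans h)).le
  refine ⟨fun hε1 => ?_, fun hε1 hlt => ?_, fun _ => hbdry⟩
  -- The lower boundary is treated apart because the extremal parameter `A` would vanish there.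
  · rcases hx.1.eq_or_lt with h | hlt
    · rw [hbdry h.symm, ← h, ← JohnNirenberg.candidate_self hε.le hε1, JohnNirenberg.candidate]
    refine le_antisymm (sSup_le ?_) ?_
    · rintro _ ⟨φ, ⟨hφ, e₁, e₂⟩, rfl⟩
      have := JohnNirenberg.expAvg_le_candidate hab hε hε1 hφ
      rwa [e₁, e₂] at this
    · obtain ⟨A, u, hA, hAb, eA, eu, e₁, e₂⟩ := JohnNirenberg.exists_extremal hab hε hx hlt
      refine le_trans (le_of_eq ?_)
        (JohnNirenberg.le_bellman (JohnNirenberg.extremal_mem_bmoBall hab hε.le A u) e₁ e₂)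
      rw [JohnNirenberg.expAvg_extremal hA hAb hε1, ← eu, eA]
      congr 1
      have h1 : 1 - ε ≠ 0 := by linarith
      field_simp
      ring
  · obtain ⟨A, u, hA, hAb, -, -, e₁, e₂⟩ := JohnNirenberg.exists_extremal hab hε hx hlt
    rw [← top_le_iff, ← JohnNirenberg.expAvg_extremal_eq_top hA hAb hε1 u]
    exact JohnNirenberg.le_bellman (JohnNirenberg.extremal_mem_bmoBall hab hε.le A u) e₁ e₂
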